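/- **Setting.** Let $1\le m\le n$ and $N\ge1$ be integers. For $A,B\in\mathbb R^{m\times n}$ write $\langle A,B\rangle=\sum_{i,j}A_{ij}B_{ij}$, $\|A\|_F=\langle A,A\rangle^{1/2}$ and $\|A\|_{\max}=\max_{i,j}|A_{ij}|$. Let $\mathcal R$ be a norm on $\mathbb R^{m\times n}$ with dual norm $\mathcal R^*(Y)=\sup_{\mathcal R(A)\le1}\langle A,Y\rangle$, and let $\mathcal M\subseteq\overline{\mathcal M}\subseteq\mathbb R^{m\times n}$ be linear subspaces. Put $$\Psi=\Psi(\overline{\mathcal M})=\sup_{A\in\overline{\mathcal M}\setminus\{0\}}\frac{\mathcal R(A)}{\|A\|_F}\quad(\Psi=0\text{ if }\overline{\mathcal M}=\{0\}),\qquad \Psi_{\min}=\inf_{A\ne0}\frac{\mathcal R(A)}{\|A\|_F}.$$ *Exponential family.* Let $\rho$ be a measure on $\mathbb R$ (for example Lebesgue or counting measure) and $h\ge0$ a measurable function such that $\int h(x)e^{x\theta}\,d\rho(x)<\infty$ for all $\theta\in\mathbb R$ and $G(\theta)=\log\int h(x)e^{x\theta}\,d\rho(x)$ is strictly convex and analytic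 on $\mathbb R$. Let $\Theta^*\in\mathbb R^{m\times n}$, and let the entries $X_{ij}$ of the random matrix $X$ be independent, $X_{ij}$ having density $h(x)\exp(x\Theta^*_{ij}-G(\Theta^*_{ij}))$ with respect to $\rho$. Let $g(\Theta)$ be the matrix with entries $G'(\Theta_{ij})$. *Sampling.* Let $\Omega=((i_1,j_1),\dots,(i_N,j_N))$ consist of $N=|\Omega|$ independent uniform positions in $[m]\times[n]$ (repetitions are kept), independent of $X$, and let $\mathcal P_\Omega(A)=\sum_{k=1}^N A_{i_kj_k}e_{i_k}e_{j_k}^\top$. With independent uniform signs $\epsilon_k\in\{-1,1\}$, independent of $\Omega$, put $$\kappa_{\mathcal R}=\mathbb E\Big[\tfrac{\sqrt{mn}}{N}\,\mathcal R^*\Big(\sum_{k=1}^N\epsilon_ke_{i_k}e_{j_k}^\top\Big)\Big].$$ *Assumptions.* (1) $\mathcal R(A+Y)=\mathcal R(A)+\mathcal R(Y)$ for all $A\in\mathcal M$ and $Y\in\overline{\mathcal M}^\perp$, and $\Theta^*\in\mathcal M$. (2) For some $\eta>0$, $G''(u)\ge e^{-\eta|u|}$ for all $u\in\mathbb R$.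 (3) For a known $\alpha^*>0$, $\|\Theta^*\|_{\max}\le\alpha^*/\sqrt{mn}$. *Estimator.* For $\lambda>0$, $\widehat\Theta$ is any minimizer of $$\frac{mn}{N}\sum_{k=1}^N\big[G(\Theta_{i_kj_k})-X_{i_kj_k}\Theta_{i_kj_k}\big]+\lambda\mathcal R(\Theta)\quad\text{over}\quad\|\Theta\|_{\max}\le\frac{\alpha^*}{\sqrt{mn}}.$$ **Theorem.** For every $\beta>0$ there are constants $K_\beta>0$ and $C_\beta>0$, depending only on $\beta$, such that for every $c_0\ge C_\beta$ and in every setting as above with $|\Omega|\le n^2$ and $|\Omega|\ge c_0\Psi^2(\overline{\mathcal M})\,n\log n$ the following holds. Let $$\mu_{\mathcal L}=e^{-2\eta\alpha^*/\sqrt{mn}}\Big(K_\beta-\frac{64}{c_0}\sqrt{\frac{|\Omega|\,\kappa_{\mathcal R}^2}{n\log n}}\Big)$$ and suppose that $\mu_{\mathcal L}>0$. Then there is an event of probability $>1-4\exp(-(1+\beta)\Psi_{\min}^4\log^2n)$ on which, for every $\lambda>0$ with $\frac\lambda2\ge\frac{mn}{|\Omega|}\mathcal R^*(\mathcal P_\Omega(X-g(\Theta^*)))$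 and every minimizer $\widehat\Theta$ above, $$\|\widehat\Theta-\Theta^*\|_F^2\le\Psi^2(\overline{\mathcal M})\max\Big\{\frac{3\lambda^2}{2\mu_{\mathcal L}^2},\ \frac{c_0^2\,\alpha^{*2}\,n\log n}{|\Omega|}\Big\}.$$ (For $n=1$ the probability bound is negative and the claim is trivial.) -/

import Mathlib

open MeasureTheory ProbabilityTheory
open scoped BigOperators

noncomputable section

namespace MatrixCompletion

/-! ### Matrices, norms and subspaces -/

section Matrices

variable {m n : ℕ}

/-- The trace inner product `⟨A, B⟩ = ∑ᵢⱼ Aᵢⱼ Bᵢⱼ`. -/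
def matInner (A B : Matrix (Fin m) (Fin n) ℝ) : ℝ := ∑ i, ∑ j, A i j * B i j

/-- The Frobenius norm. -/
def frobNorm (A : Matrix (Fin m) (Fin n) ℝ) : ℝ := Real.sqrt (∑ i, ∑ j, A i j ^ 2)

/-- The maximum norm `maxᵢⱼ |Aᵢⱼ|`. -/
def maxNorm (A : Matrix (Fin m) (Fin n) ℝ) : ℝ := ⨆ p : Fin m × Fin n, |A p.1 p.2|

/-- `R` is a norm on the space of `m × n` matrices (a positive definite seminorm). -/
def IsMatrixNorm (R : Seminorm ℝ (Matrix (Fin m) (Fin n) ℝ)) : Prop :=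
  ∀ A, R A = 0 → A = 0

/-- The dual norm `R*(Y) = sup {⟨A, Y⟩ : R A ≤ 1}`. -/
def dualNorm (R : Seminorm ℝ (Matrix (Fin m) (Fin n) ℝ)) (Y : Matrix (Fin m) (Fin n) ℝ) : ℝ :=
  sSup {r : ℝ | ∃ A, R A ≤ 1 ∧ r = matInner A Y}

/-- Membership in the orthogonal complement of `V` for the trace inner product. -/
def IsOrthTo (V : Submodule ℝ (Matrix (Fin m) (Fin n) ℝ)) (Y : Matrix (Fin m) (Fin n) ℝ) : Prop :=
  ∀ Z ∈ V, matInner Z Y = 0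

/-- `R` is decomposable over the pair `(M, Mbarᗮ)`. -/
def IsDecomposable (R : Seminorm ℝ (Matrix (Fin m) (Fin n) ℝ))
    (M Mbar : Submodule ℝ (Matrix (Fin m) (Fin n) ℝ)) : Prop :=
  ∀ A ∈ M, ∀ Y, IsOrthTo Mbar Y → R (A + Y) = R A + R Y

/-- The maximum subspace compatibility constant `sup {R A / ‖A‖_F : A ∈ V, A ≠ 0}`
(equal to `0` for the zero subspace). -/
def psiMax (R : Seminorm ℝ (Matrix (Fin m) (Fin n) ℝ))
    (V : Submodule ℝ (Matrix (Fin m) (Fin n) ℝ)) : ℝ :=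
  sSup {r : ℝ | ∃ A ∈ V, A ≠ 0 ∧ r = R A / frobNorm A}

/-- The minimum compatibility constant `inf {R A / ‖A‖_F : A ≠ 0}`. -/
def psiMin (R : Seminorm ℝ (Matrix (Fin m) (Fin n) ℝ)) : ℝ :=
  sInf {r : ℝ | ∃ A : Matrix (Fin m) (Fin n) ℝ, A ≠ 0 ∧ r = R A / frobNorm A}

end Matrices

/-! ### Natural exponential families -/

/-- `G : ℝ → ℝ` is the log-partition function of the one-dimensional natural exponential family
with base density `h` relative to the reference measure `ρ` (Lebesgue measure, a counting
measure, ...), with natural parameter space all of `ℝ`; it is strictly convex and analytic. -/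
structure IsNaturalExponentialFamily (ρ : Measure ℝ) (h G : ℝ → ℝ) : Prop where
  measurable_base : Measurable h
  base_nonneg : ∀ x, 0 ≤ h x
  integrable : ∀ θ, Integrable (fun x => h x * Real.exp (x * θ)) ρ
  logPartition : ∀ θ, G θ = Real.log (∫ x, h x * Real.exp (x * θ) ∂ρ)
  strictConvex : StrictConvexOn ℝ Set.univ G
  analytic : ∀ θ, AnalyticAt ℝ G θ

/-- The member of the family with parameter `θ`: the measure with density
`h(x) exp(x θ - G(θ))` relative to `ρ`. -/
def expFamilyLaw (ρ : Measure ℝ) (h G : ℝ → ℝ) (θ : ℝ) : Measure ℝ :=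
  ρ.withDensity fun x => ENNReal.ofReal (h x * Real.exp (x * θ - G θ))

/-! ### The observation model -/

section Model

variable {m n N : ℕ}

/-- On the probability space `(S, P)`: the entries of the random matrix `X` are independent with
`X i j` drawn from the member of the family with parameter `Θ i j`; the `N` sampled positions
`I 0, ..., I (N-1)` are independent and uniform on `[m] × [n]` (repetitions allowed); and the
positions are independent of `X`. -/
structure IsObservationModel {S : Type*} [MeasurableSpace S] (P : Measure S)
    (ρ : Measure ℝ) (h G : ℝ → ℝ) (Θ : Matrix (Fin m) (Fin n) ℝ)
    (X : S → Matrix (Fin m) (Fin n) ℝ) (I : Fin N → S → Fin m × Fin n) : Prop where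
  measurable_entry : ∀ i j, Measurable fun ω => X ω i j
  law_entry : ∀ i j, P.map (fun ω => X ω i j) = expFamilyLaw ρ h G (Θ i j)
  indep_entries : iIndepFun (fun (p : Fin m × Fin n) ω => X ω p.1 p.2) P
  measurable_index : ∀ k, Measurable (I k)
  uniform_index : ∀ k p, P.real {ω | I k ω = p} = 1 / ((m : ℝ) * n)
  indep_index : iIndepFun I P
  indep : IndepFun (fun ω (p : Fin m × Fin n) => X ω p.1 p.2) (fun ω k => I k ω) P

/-- The sampling operator `∑ₖ A_{iₖ jₖ} e_{iₖ} e_{jₖ}ᵀ`; a position sampled several times is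
counted with its multiplicity. -/
def sampleOp (I : Fin N → Fin m × Fin n) (A : Matrix (Fin m) (Fin n) ℝ) :
    Matrix (Fin m) (Fin n) ℝ :=
  ∑ k, Matrix.single (I k).1 (I k).2 (A (I k).1 (I k).2)

/-- The gradient map `g(Θ)`, which is `G'` applied to every entry. -/
def gradMap (G : ℝ → ℝ) (Θ : Matrix (Fin m) (Fin n) ℝ) : Matrix (Fin m) (Fin n) ℝ :=
  Matrix.of fun i j => deriv G (Θ i j)

/-- The regularized negative log-likelihood
`(mn/N) ∑ₖ (G(Θ_{iₖ jₖ}) - X_{iₖ jₖ} Θ_{iₖ jₖ}) + lam * R(Θ)`. -/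
def objective (G : ℝ → ℝ) (R : Seminorm ℝ (Matrix (Fin m) (Fin n) ℝ)) (lam : ℝ)
    (I : Fin N → Fin m × Fin n) (X Θ : Matrix (Fin m) (Fin n) ℝ) : ℝ :=
  ((m : ℝ) * n / N) *
      ∑ k, (G (Θ (I k).1 (I k).2) - X (I k).1 (I k).2 * Θ (I k).1 (I k).2)
    + lam * R Θ

/-- `Θhat` is a minimizer of the objective under the constraint `‖Θ‖_max ≤ α / √(mn)`. -/
def IsEstimator (G : ℝ → ℝ) (R : Seminorm ℝ (Matrix (Fin m) (Fin n) ℝ)) (lam α : ℝ)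
    (I : Fin N → Fin m × Fin n) (X Θhat : Matrix (Fin m) (Fin n) ℝ) : Prop :=
  maxNorm Θhat ≤ α / Real.sqrt ((m : ℝ) * n) ∧
    ∀ Θ : Matrix (Fin m) (Fin n) ℝ, maxNorm Θ ≤ α / Real.sqrt ((m : ℝ) * n) →
      objective G R lam I X Θhat ≤ objective G R lam I X Θ

/-- `κ_R = E[(√(mn)/N) R*(∑ₖ εₖ e_{iₖ} e_{jₖ}ᵀ)]`, the expectation being over `N` independent
uniform positions `(iₖ, jₖ)` and `N` independent uniform signs `εₖ`, that is, a uniform average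
over all sequences of positions and all sequences of signs. -/
def kappa (R : Seminorm ℝ (Matrix (Fin m) (Fin n) ℝ)) (N : ℕ) : ℝ :=
  Finset.expect Finset.univ fun I : Fin N → Fin m × Fin n =>
    Finset.expect Finset.univ fun ε : Fin N → ℤˣ =>
      Real.sqrt ((m : ℝ) * n) / N *
        dualNorm R (∑ k, Matrix.single (I k).1 (I k).2 (((ε k : ℤ) : ℝ)))

/-- `μ_L = exp(-2ηα/√(mn)) (K - (64/c₀) √(N κ_R² / (n log n)))`. -/
def muL (R : Seminorm ℝ (Matrix (Fin m) (Fin n) ℝ)) (N : ℕ) (η α K c₀ : ℝ) : ℝ :=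
  Real.exp (-(2 * η * α / Real.sqrt ((m : ℝ) * n))) *
    (K - 64 / c₀ * Real.sqrt (N * kappa R N ^ 2 / (n * Real.log n)))

end Model

end MatrixCompletion

end

open MatrixCompletion

/-! Write `Δ = Θhat - Θstar`, `Ψ = psiMax R Mbar`, and let `τ` be the exponential factor of `muL`.
The only random input is a lower bound for the sampled energy `(mn/N) ∑ₖ Δ²`, whose mean is
`‖Δ‖_F²`.

Optimality, curvature of `G`, the dual-norm bound on the noise and decomposability give the cone
condition `R Δ ≤ 4Ψ‖Δ‖_F` and `τ * energy ≤ 3λΨ‖Δ‖_F` (`estimator_basic_inequality`). If `‖Δ‖_F²` is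
below the second term of the bound, nothing remains to prove. Otherwise `Δ/‖Δ‖_F` has spikiness at
most `b = (2/(c₀Ψ))√(N/(n log n))` and lies in a fixed class of unit matrices. The energy is
homogeneous, so no peeling over the size of `Δ` is needed.

On that class the energy is at least `1/2 - 16bΨκ` simultaneously, except with probability
`exp(-N/(8b⁴))` (`expect_not_restrictedlyConvex_le`). McDiarmid concentrates the largest deficit
about its mean, symmetrization and contraction reduce the mean to a Rademacher average, and duality
bounds that average through `κ`. The lower bound is at least `3μ/τ`, which yields the rate
(`estimator_rate`). Finally `N ≤ n²` makes the exponent at least `(c₀⁴/128) Ψ⁴ log² n`, and `Ψ ≥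
Ψ_min` outside the degenerate case `Mbar = ⊥`. -/

section FiniteProbability

/-! ### Exponential moments and McDiarmid's inequality -/

open Finset

/-- Averaging over sequences of length `N + 1` is averaging over the head and then the tail. -/
theorem expect_fin_cons {T : Type*} [Fintype T] {N : ℕ} (g : (Fin (N + 1) → T) → ℝ) :
    (𝔼 J, g J) = 𝔼 x, 𝔼 J : Fin N → T, g (Fin.cons x J) := by
  rw [← Finset.expect_product', Finset.univ_product_univ]
  exact (Fintype.expect_equiv (Fin.consEquiv fun _ => T) _ _ fun _ => rfl).symm

/-- Hoeffding's lemma for a centred variable on a finite uniform space. -/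
theorem expect_exp_le_of_abs_le {T : Type*} [Fintype T] [Nonempty T] {Y : T → ℝ} {c : ℝ}
    (hY : (𝔼 x, Y x) = 0) (hc : ∀ x, |Y x| ≤ c) :
    (𝔼 x, Real.exp (Y x)) ≤ Real.exp (c ^ 2 / 2) := by
  have hc0 : 0 ≤ c := (abs_nonneg _).trans (hc (Classical.arbitrary T))
  rcases hc0.eq_or_lt with rfl | hc0
  · refine Finset.expect_le Finset.univ_nonempty fun x _ => ?_
    have : Y x = 0 := abs_nonpos_iff.mp (hc x)
    simp [this]
  -- On `[-c, c]` the exponential lies below its chord, which is affine in `Y`, so only its constant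
  -- term `cosh c` survives averaging.
  have key : ∀ x, Real.exp (Y x) ≤ Real.cosh c + Y x * (Real.sinh c / c) := by
    intro x
    obtain ⟨h1, h2⟩ := abs_le.mp (hc x)
    have := convexOn_exp.2 (Set.mem_univ c) (Set.mem_univ (-c))
      (show 0 ≤ (c + Y x) / (2 * c) by apply div_nonneg <;> linarith)
      (show 0 ≤ (c - Y x) / (2 * c) by apply div_nonneg <;> linarith)
      (by field_simp; ring)
    simp only [smul_eq_mul] at this
    calc Real.exp (Y x)
        = Real.exp ((c + Y x) / (2 * c) * c + (c - Y x) / (2 * c) * -c) := by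
          congr 1; field_simp; ring
      _ ≤ _ := this
      _ = _ := by rw [Real.cosh_eq, Real.sinh_eq]; field_simp; ring
  calc (𝔼 x, Real.exp (Y x)) ≤ 𝔼 x, (Real.cosh c + Y x * (Real.sinh c / c)) :=
        Finset.expect_le_expect fun x _ => key x
    _ = Real.cosh c := by
        rw [Finset.expect_add_distrib, ← Finset.expect_mul, hY,
          Fintype.expect_const, zero_mul, add_zero]
    _ ≤ _ := Real.cosh_le_exp_half_sq c

/-- The exponential moment bound behind McDiarmid's inequality. -/
theorem expect_exp_le_of_bounded_differences {T : Type*} [Fintype T] [Nonempty T] {c : ℝ} :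
    ∀ {N : ℕ} (g : (Fin N → T) → ℝ),
      (∀ J k x, |g (Function.update J k x) - g J| ≤ c) →
      (𝔼 J, Real.exp (g J - 𝔼 J', g J')) ≤ Real.exp (N * c ^ 2 / 2) := by
  intro N
  induction N with
  | zero =>
    intro g _
    have : ∀ J, g J = g default := fun J => congrArg g (Subsingleton.elim _ _)
    simp [this]
  | succ N ih =>
    intro g hg
    -- `H` is the conditional mean given the first coordinate. The deviation splits into `g - H`,
    -- handled by induction on the tail, and `H - 𝔼 H`, handled by Hoeffding's lemma.
    set H : T → ℝ := fun x => 𝔼 J : Fin N → T, g (Fin.cons x J) with hH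
    have hmean : (𝔼 J, g J) = 𝔼 x, H x := expect_fin_cons g
    have hdiff : ∀ x y, |H x - H y| ≤ c := by
      intro x y
      rw [hH]
      simp only
      rw [← Finset.expect_sub_distrib]
      refine (Finset.abs_expect_le _ _).trans
        (Finset.expect_le Finset.univ_nonempty fun J _ => ?_)
      have := hg (Fin.cons y J) 0 x
      rwa [Fin.update_cons_zero] at this
    have h1 : ∀ x, (𝔼 J : Fin N → T, Real.exp (g (Fin.cons x J) - H x))
        ≤ Real.exp (N * c ^ 2 / 2) := by
      intro x
      refine ih (fun J => g (Fin.cons x J)) fun J k y => ?_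
      have := hg (Fin.cons x J) k.succ y
      rwa [← Fin.cons_update] at this
    have h2 : (𝔼 x, Real.exp (H x - 𝔼 y, H y)) ≤ Real.exp (c ^ 2 / 2) := by
      refine expect_exp_le_of_abs_le ?_ fun x => ?_
      · rw [Finset.expect_sub_distrib, Fintype.expect_const, sub_self]
      · have : H x - (𝔼 y, H y) = 𝔼 y, (H x - H y) := by
          rw [Finset.expect_sub_distrib, Fintype.expect_const]
        rw [this]
        exact (Finset.abs_expect_le _ _).trans
          (Finset.expect_le Finset.univ_nonempty fun y _ => hdiff x y)
    rw [expect_fin_cons, hmean]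
    calc (𝔼 x, 𝔼 J : Fin N → T, Real.exp (g (Fin.cons x J) - 𝔼 y, H y))
        = 𝔼 x, Real.exp (H x - 𝔼 y, H y) *
            𝔼 J : Fin N → T, Real.exp (g (Fin.cons x J) - H x) := by
          refine Finset.expect_congr rfl fun x _ => ?_
          rw [Finset.mul_expect]
          refine Finset.expect_congr rfl fun J _ => ?_
          rw [← Real.exp_add]; ring_nf
      _ ≤ 𝔼 x, Real.exp (H x - 𝔼 y, H y) * Real.exp (N * c ^ 2 / 2) :=
          Finset.expect_le_expect fun x _ =>
            mul_le_mul_of_nonneg_left (h1 x) (Real.exp_pos _).le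
      _ ≤ Real.exp (c ^ 2 / 2) * Real.exp (N * c ^ 2 / 2) := by
          rw [← Finset.expect_mul]
          exact mul_le_mul_of_nonneg_right h2 (Real.exp_pos _).le
      _ = _ := by rw [← Real.exp_add]; push_cast; ring_nf

open Classical in
/-- McDiarmid's inequality on a finite uniform product space. -/
theorem mcdiarmid {T : Type*} [Fintype T] [Nonempty T] {c t : ℝ} {N : ℕ} (hN : 0 < N)
    (hc : 0 < c) (ht : 0 ≤ t) (g : (Fin N → T) → ℝ)
    (hg : ∀ J k x, |g (Function.update J k x) - g J| ≤ c) :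
    (𝔼 J, if (𝔼 J', g J') + t < g J then (1 : ℝ) else 0)
      ≤ Real.exp (-(t ^ 2 / (2 * (N * c ^ 2)))) := by
  have hN' : (0 : ℝ) < N := by exact_mod_cast hN
  -- Minimizer of the Chernoff exponent `N(sc)²/2 - st`.
  set s : ℝ := t / (N * c ^ 2) with hs
  have hs0 : 0 ≤ s := by positivity
  have hmean : (𝔼 J, s * g J) = s * 𝔼 J, g J := (Finset.mul_expect _ _ _).symm
  have hexp := expect_exp_le_of_bounded_differences (c := s * c) (fun J => s * g J) (by
    intro J k x
    rw [← mul_sub, abs_mul, abs_of_nonneg hs0]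
    exact mul_le_mul_of_nonneg_left (hg J k x) hs0)
  simp only [hmean] at hexp
  calc (𝔼 J, if (𝔼 J', g J') + t < g J then (1 : ℝ) else 0)
      ≤ 𝔼 J, Real.exp (s * g J - s * 𝔼 J', g J') * Real.exp (-(s * t)) := by
        refine Finset.expect_le_expect fun J _ => ?_
        rw [← Real.exp_add]
        split_ifs with h
        · refine Real.one_le_exp ?_
          nlinarith
        · exact (Real.exp_pos _).le
    _ ≤ Real.exp (N * (s * c) ^ 2 / 2) * Real.exp (-(s * t)) := by
        rw [← Finset.expect_mul]
        exact mul_le_mul_of_nonneg_right hexp (Real.exp_pos _).le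
    _ = _ := by
        rw [← Real.exp_add]
        congr 1
        rw [hs]; field_simp; ring

/-! ### Rademacher averages: contraction and symmetrization -/

theorem expect_units_int (f : ℤˣ → ℝ) : (𝔼 e, f e) = (f 1 + f (-1)) / 2 := by
  rw [Fintype.expect_eq_sum_div_card, UnitsInt.univ, Finset.sum_pair (by decide)]
  simp

/-- The two-point comparison underlying the contraction principle. -/
theorem ciSup_add_ciSup_sub_le {ι : Type*} [Nonempty ι] {u v w : ι → ℝ} {B : ℝ}
    (hu : ∀ i, |u i| ≤ B) (hw : ∀ i, |w i| ≤ B)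
    (hvw : ∀ i j, |v i - v j| ≤ |w i - w j|) :
    (⨆ i, (u i + v i)) + (⨆ i, (u i - v i)) ≤ (⨆ i, (u i + w i)) + ⨆ i, (u i - w i) := by
  have hb1 : BddAbove (Set.range fun i => u i + w i) := by
    refine ⟨B + B, ?_⟩
    rintro _ ⟨i, rfl⟩
    exact add_le_add ((le_abs_self _).trans (hu i)) ((le_abs_self _).trans (hw i))
  have hb2 : BddAbove (Set.range fun i => u i - w i) := by
    refine ⟨B + B, ?_⟩
    rintro _ ⟨i, rfl⟩
    have := (neg_le_abs (w i)).trans (hw i)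
    have := (le_abs_self (u i)).trans (hu i)
    simp only
    linarith
  refine ciSup_add_ciSup_le fun i j => ?_
  -- Depending on the sign of `w i - w j`, the right-hand suprema are tested at `(i, j)` or at `(j,
  -- i)`.
  have h1 := le_ciSup hb1 i
  have h2 := le_ciSup hb2 j
  have h3 := le_ciSup hb1 j
  have h4 := le_ciSup hb2 i
  have h := (le_abs_self _).trans (hvw i j)
  rcases abs_cases (w i - w j) with ⟨h5, _⟩ | ⟨h5, _⟩ <;> linarith

theorem abs_sum_units_mul_le {N : ℕ} (ε : Fin N → ℤˣ) {φ : Fin N → ℝ} {B : ℝ}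
    (hφ : ∀ k, |φ k| ≤ B) : |∑ k, ((ε k : ℤ) : ℝ) * φ k| ≤ N * B := by
  refine (Finset.abs_sum_le_sum_abs _ _).trans ?_
  refine (Finset.sum_le_card_nsmul _ _ B fun k _ => ?_).trans (by simp)
  rcases Int.units_eq_one_or (ε k) with h | h <;> simpa [h] using hφ k

/-- The contraction principle for Rademacher averages. -/
theorem expect_ciSup_contraction {ι : Type*} [Nonempty ι] {B : ℝ} :
    ∀ {N : ℕ} (u : ι → ℝ) (φ ψ : ι → Fin N → ℝ), (∃ D, ∀ i, |u i| ≤ D) →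
      (∀ i k, |φ i k| ≤ B) → (∀ i k, |ψ i k| ≤ B) →
      (∀ i j k, |φ i k - φ j k| ≤ |ψ i k - ψ j k|) →
      (𝔼 ε : Fin N → ℤˣ, ⨆ i, (u i + ∑ k, ((ε k : ℤ) : ℝ) * φ i k)) ≤
        𝔼 ε : Fin N → ℤˣ, ⨆ i, (u i + ∑ k, ((ε k : ℤ) : ℝ) * ψ i k) := by
  intro N
  induction N with
  | zero => intro u φ ψ _ _ _ _; simp
  | succ N ih =>
    intro u φ ψ ⟨D, hD⟩ hφ hψ hφψ
    rw [expect_fin_cons, expect_fin_cons]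
    simp only [Fin.sum_univ_succ, Fin.cons_zero, Fin.cons_succ]
    calc (𝔼 e : ℤˣ, 𝔼 ε : Fin N → ℤˣ,
          ⨆ i, (u i + (((e : ℤ) : ℝ) * φ i 0 + ∑ k : Fin N, ((ε k : ℤ) : ℝ) * φ i k.succ)))
        ≤ 𝔼 e : ℤˣ, 𝔼 ε : Fin N → ℤˣ,
          ⨆ i, (u i + (((e : ℤ) : ℝ) * φ i 0 + ∑ k : Fin N, ((ε k : ℤ) : ℝ) * ψ i k.succ)) := by
          refine Finset.expect_le_expect fun e _ => ?_
          -- The offset `u` absorbs the head term, which is why the induction carries it.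
          have := ih (fun i => u i + ((e : ℤ) : ℝ) * φ i 0) (fun i k => φ i k.succ)
            (fun i k => ψ i k.succ) ⟨D + B, fun i => ?_⟩ (fun i k => hφ i _) (fun i k => hψ i _)
            (fun i j k => hφψ i j _)
          · simpa only [add_assoc] using this
          · refine (abs_add_le _ _).trans (add_le_add (hD i) ?_)
            rcases Int.units_eq_one_or e with h | h <;> simpa [h] using hφ i 0
      _ ≤ _ := by
          -- With the tail signs frozen, averaging over the head sign is the two-point comparison.
          rw [Finset.expect_comm, Finset.expect_comm (s := Finset.univ (α := ℤˣ))]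
          refine Finset.expect_le_expect fun ε _ => ?_
          rw [expect_units_int, expect_units_int]
          have hu : ∀ i, |u i + ∑ k : Fin N, ((ε k : ℤ) : ℝ) * ψ i k.succ|
              ≤ max (D + N * B) B := fun i =>
            ((abs_add_le _ _).trans (add_le_add (hD i)
              (abs_sum_units_mul_le ε fun k => hψ i _))).trans (le_max_left _ _)
          have := ciSup_add_ciSup_sub_le hu
            (fun i => (hψ i 0).trans (le_max_right _ _)) (fun i j => hφψ i j 0)
          have e1 : ∀ a b c : ℝ, a + (((1 : ℤˣ) : ℤ) * b + c) = a + c + b := by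
            intros; push_cast; ring
          have e2 : ∀ a b c : ℝ, a + (((-1 : ℤˣ) : ℤ) * b + c) = a + c - b := by
            intros; push_cast; ring
          simp only [e1, e2]
          linarith

/-- Exchange of the entries of two sequences at the positions with negative sign. -/
def swapNegative {T : Type*} {N : ℕ} (ε : Fin N → ℤˣ) :
    (Fin N → T) × (Fin N → T) ≃ (Fin N → T) × (Fin N → T) where
  toFun p := (fun k => if ε k = 1 then p.1 k else p.2 k, fun k => if ε k = 1 then p.2 k else p.1 k)
  invFun p :=
    (fun k => if ε k = 1 then p.1 k else p.2 k, fun k => if ε k = 1 then p.2 k else p.1 k)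
  left_inv p := by ext k <;> by_cases h : ε k = 1 <;> simp [h]
  right_inv p := by ext k <;> by_cases h : ε k = 1 <;> simp [h]

/-- Symmetrization of the one-sided deviation of an empirical process. -/
theorem expect_ciSup_symmetrization {T ι : Type*} [Fintype T] [Nonempty T] [Nonempty ι] {N : ℕ}
    {B : ℝ} (F : ι → T → ℝ) (hF : ∀ i x, |F i x| ≤ B) :
    (𝔼 J : Fin N → T, ⨆ i, ((𝔼 J' : Fin N → T, ∑ k, F i (J' k)) - ∑ k, F i (J k))) ≤
      2 * 𝔼 J : Fin N → T, 𝔼 ε : Fin N → ℤˣ, ⨆ i, ∑ k, ((ε k : ℤ) : ℝ) * F i (J k) := by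
  have hsum : ∀ (J : Fin N → T) (ε : Fin N → ℤˣ) i,
      |∑ k, ((ε k : ℤ) : ℝ) * F i (J k)| ≤ N * B :=
    fun J ε i => abs_sum_units_mul_le ε fun k => hF i _
  have hbS : ∀ (J : Fin N → T) (ε : Fin N → ℤˣ),
      BddAbove (Set.range fun i => ∑ k, ((ε k : ℤ) : ℝ) * F i (J k)) := by
    intro J ε
    refine ⟨N * B, ?_⟩
    rintro _ ⟨i, rfl⟩
    exact (le_abs_self _).trans (hsum J ε i)
  have hbD : ∀ J J' : Fin N → T,
      BddAbove (Set.range fun i => ∑ k, F i (J' k) - ∑ k, F i (J k)) := by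
    intro J J'
    refine ⟨N * B + N * B, ?_⟩
    rintro _ ⟨i, rfl⟩
    have h1 := (le_abs_self _).trans (hsum J' 1 i)
    have h2 := (neg_le_abs _).trans (hsum J 1 i)
    simp only [Pi.one_apply, Units.val_one, Int.cast_one, one_mul] at h1 h2
    simp only
    linarith
  -- The mean is realized by an independent ghost sample, and the supremum of an average is at most
  -- the average of suprema.
  have hghost : (𝔼 J : Fin N → T, ⨆ i, ((𝔼 J' : Fin N → T, ∑ k, F i (J' k)) - ∑ k, F i (J k)))
      ≤ 𝔼 p : (Fin N → T) × (Fin N → T), ⨆ i, (∑ k, F i (p.2 k) - ∑ k, F i (p.1 k)) := by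
    rw [← Finset.univ_product_univ, Finset.expect_product]
    refine Finset.expect_le_expect fun J _ => ciSup_le fun i => ?_
    calc (𝔼 J' : Fin N → T, ∑ k, F i (J' k)) - ∑ k, F i (J k)
        = 𝔼 J' : Fin N → T, (∑ k, F i (J' k) - ∑ k, F i (J k)) := by
          rw [Finset.expect_sub_distrib, Fintype.expect_const]
      _ ≤ _ := Finset.expect_le_expect fun J' _ => le_ciSup (hbD J J') i
  -- Swapping the two samples wherever `ε k = -1` preserves the uniform law and flips those
  -- summands.
  have hswap : ∀ ε : Fin N → ℤˣ,
      (𝔼 p : (Fin N → T) × (Fin N → T), ⨆ i, (∑ k, F i (p.2 k) - ∑ k, F i (p.1 k))) =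
      𝔼 p : (Fin N → T) × (Fin N → T), ⨆ i, (∑ k, ((ε k : ℤ) : ℝ) * F i (p.2 k) +
        ∑ k, (((-ε) k : ℤ) : ℝ) * F i (p.1 k)) := by
    intro ε
    refine (Fintype.expect_equiv (swapNegative ε) _ _ fun p => ?_).symm
    refine iSup_congr fun i => ?_
    rw [← Finset.sum_add_distrib, ← Finset.sum_sub_distrib]
    refine Finset.sum_congr rfl fun k _ => ?_
    rcases Int.units_eq_one_or (ε k) with h | h
    · simp [swapNegative, h]; ring
    · simp [swapNegative, h]; ring
  have hsplit : ∀ ε : Fin N → ℤˣ,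
      (𝔼 p : (Fin N → T) × (Fin N → T), ⨆ i, (∑ k, F i (p.2 k) - ∑ k, F i (p.1 k))) ≤
      (𝔼 J : Fin N → T, ⨆ i, ∑ k, ((ε k : ℤ) : ℝ) * F i (J k)) +
        𝔼 J : Fin N → T, ⨆ i, ∑ k, (((-ε) k : ℤ) : ℝ) * F i (J k) := by
    intro ε
    rw [hswap ε, ← Finset.univ_product_univ, Finset.expect_product]
    calc _ ≤ 𝔼 J : Fin N → T, 𝔼 J' : Fin N → T,
          ((⨆ i, ∑ k, ((ε k : ℤ) : ℝ) * F i (J' k)) +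
            ⨆ i, ∑ k, (((-ε) k : ℤ) : ℝ) * F i (J k)) := by
          refine Finset.expect_le_expect fun J _ => Finset.expect_le_expect fun J' _ => ?_
          exact ciSup_le fun i => add_le_add (le_ciSup (hbS J' ε) i) (le_ciSup (hbS J (-ε)) i)
      _ = _ := by
          simp only [Finset.expect_add_distrib, Fintype.expect_const]
  have hneg : (𝔼 ε : Fin N → ℤˣ, 𝔼 J : Fin N → T, ⨆ i, ∑ k, (((-ε) k : ℤ) : ℝ) * F i (J k))
      = 𝔼 ε : Fin N → ℤˣ, 𝔼 J : Fin N → T, ⨆ i, ∑ k, ((ε k : ℤ) : ℝ) * F i (J k) :=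
    Fintype.expect_equiv (Equiv.neg _) _ _ fun ε => rfl
  refine hghost.trans ?_
  rw [Finset.expect_comm]
  calc _ ≤ 𝔼 ε : Fin N → ℤˣ, ((𝔼 J : Fin N → T, ⨆ i, ∑ k, ((ε k : ℤ) : ℝ) * F i (J k)) +
        𝔼 J : Fin N → T, ⨆ i, ∑ k, (((-ε) k : ℤ) : ℝ) * F i (J k)) :=
        Finset.le_expect Finset.univ_nonempty fun ε _ => hsplit ε
    _ = _ := by rw [Finset.expect_add_distrib, hneg, two_mul]

/-- The average of a sum of identical statistics of the coordinates. -/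
theorem expect_sum_coordinates {T : Type*} [Fintype T] [Nonempty T] (f : T → ℝ) :
    ∀ N : ℕ, (𝔼 J : Fin N → T, ∑ k, f (J k)) = N * 𝔼 x, f x := by
  intro N
  induction N with
  | zero => simp
  | succ N ih =>
    rw [expect_fin_cons]
    simp only [Fin.sum_univ_succ, Fin.cons_zero, Fin.cons_succ, Finset.expect_add_distrib,
      Fintype.expect_const, ih]
    push_cast; ring

/-! ### Uniform lower bound for empirical second moments -/

open Classical in
/-- A lower bound, uniform over a class of bounded functions, for the empirical second moment. -/
theorem uniform_empirical_second_moment {T ι : Type*} [Fintype T] [Nonempty T] {N : ℕ}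
    (hN : 0 < N) {b σ t Q : ℝ} (hb : 0 < b) (ht : 0 ≤ t) (f : ι → T → ℝ)
    (hf : ∀ i x, |f i x| ≤ b) (hσ : ∀ i, (𝔼 x, f i x ^ 2) = σ)
    (W : (Fin N → T) → (Fin N → ℤˣ) → ℝ)
    (hW : ∀ J ε i, ∑ k, ((ε k : ℤ) : ℝ) * f i (J k) ≤ W J ε)
    (hQ : (𝔼 J, 𝔼 ε, W J ε) ≤ Q) :
    (𝔼 J : Fin N → T, if ∀ i, N * σ - 4 * b * Q - N * t ≤ ∑ k, f i (J k) ^ 2 then (0 : ℝ) else 1)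
      ≤ Real.exp (-(N * t ^ 2 / (2 * b ^ 4))) := by
  rcases isEmpty_or_nonempty ι with hι | hι
  · simp [Real.exp_nonneg]
  have hN' : (0 : ℝ) < N := by exact_mod_cast hN
  have hsq : ∀ i x, |f i x ^ 2| ≤ b ^ 2 := by
    intro i x
    rw [abs_pow]
    exact pow_le_pow_left₀ (abs_nonneg _) (hf i x) 2
  -- The worst deficit over the class. Squares lie in `[0, b²]`, so changing one sample moves it by
  -- at most `b²`.
  set g : (Fin N → T) → ℝ := fun J => ⨆ i, (N * σ - ∑ k, f i (J k) ^ 2) with hg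
  have hbg : ∀ J : Fin N → T, BddAbove (Set.range fun i => N * σ - ∑ k, f i (J k) ^ 2) := by
    intro J
    refine ⟨N * σ, ?_⟩
    rintro _ ⟨i, rfl⟩
    exact sub_le_self _ (Finset.sum_nonneg fun k _ => sq_nonneg _)
  have hbd1 : ∀ (J : Fin N → T) k x, g (Function.update J k x) - g J ≤ b ^ 2 := by
    intro J k x
    rw [sub_le_iff_le_add']
    refine ciSup_le fun i => ?_
    have h1 := le_ciSup (hbg J) i
    have h2 : (∑ l, f i (J l) ^ 2) - b ^ 2 ≤ ∑ l, f i (Function.update J k x l) ^ 2 := by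
      rw [← Finset.add_sum_erase _ _ (Finset.mem_univ k),
        ← Finset.add_sum_erase _ (fun l => f i (Function.update J k x l) ^ 2) (Finset.mem_univ k)]
      have h3 : ∑ l ∈ Finset.univ.erase k, f i (Function.update J k x l) ^ 2
          = ∑ l ∈ Finset.univ.erase k, f i (J l) ^ 2 :=
        Finset.sum_congr rfl fun l hl => by
          rw [Function.update_of_ne (Finset.ne_of_mem_erase hl)]
      rw [h3]
      have h4 := (le_abs_self _).trans (hsq i (J k))
      have h5 := sq_nonneg (f i (Function.update J k x k))
      linarith
    rw [hg]; simp only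
    linarith
  have hbd : ∀ (J : Fin N → T) k x, |g (Function.update J k x) - g J| ≤ b ^ 2 := by
    intro J k x
    refine abs_sub_le_iff.mpr ⟨hbd1 J k x, ?_⟩
    have := hbd1 (Function.update J k x) k (J k)
    rwa [Function.update_idem, Function.update_eq_self] at this
  -- `4b` is 2 from symmetrization times the Lipschitz constant `2b` of squaring on `[-b, b]`.
  have hmean : (𝔼 J, g J) ≤ 4 * b * Q := by
    have hm : ∀ i, (𝔼 J' : Fin N → T, ∑ k, f i (J' k) ^ 2) = N * σ := fun i => by
      rw [expect_sum_coordinates (fun x => f i x ^ 2), hσ i]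
    have hsym := expect_ciSup_symmetrization (N := N) (fun i x => f i x ^ 2) hsq
    simp only [hm] at hsym
    refine hsym.trans ?_
    have hcontr : ∀ J : Fin N → T,
        (𝔼 ε : Fin N → ℤˣ, ⨆ i, ∑ k, ((ε k : ℤ) : ℝ) * f i (J k) ^ 2) ≤
          𝔼 ε, 2 * b * W J ε := by
      intro J
      have h := expect_ciSup_contraction (ι := ι) (B := 2 * b * b) (fun _ => 0)
        (fun i k => f i (J k) ^ 2) (fun i k => 2 * b * f i (J k)) ⟨0, by simp⟩
        (fun i k => (hsq i _).trans (by nlinarith)) (fun i k => by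
          rw [abs_mul, abs_of_pos (by positivity : (0 : ℝ) < 2 * b)]
          exact mul_le_mul_of_nonneg_left (hf i _) (by positivity))
        (fun i j k => by
          rw [← mul_sub, sq_sub_sq, abs_mul, abs_mul, abs_of_pos (by positivity : (0 : ℝ) < 2 * b)]
          refine mul_le_mul_of_nonneg_right ((abs_add_le _ _).trans ?_) (abs_nonneg _)
          linarith [hf i (J k), hf j (J k)])
      simp only [zero_add] at h
      refine h.trans (Finset.expect_le_expect fun ε _ => ciSup_le fun i => ?_)
      calc (∑ k, ((ε k : ℤ) : ℝ) * (2 * b * f i (J k)))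
          = 2 * b * ∑ k, ((ε k : ℤ) : ℝ) * f i (J k) := by
            rw [Finset.mul_sum]; exact Finset.sum_congr rfl fun k _ => by ring
        _ ≤ _ := mul_le_mul_of_nonneg_left (hW J ε i) (by positivity)
    calc _ ≤ 2 * 𝔼 J, 𝔼 ε, 2 * b * W J ε :=
          mul_le_mul_of_nonneg_left (Finset.expect_le_expect fun J _ => hcontr J) zero_le_two
      _ = 4 * b * 𝔼 J, 𝔼 ε, W J ε := by
          simp only [← Finset.mul_expect]; ring
      _ ≤ _ := mul_le_mul_of_nonneg_left hQ (by positivity)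
  have hmc := mcdiarmid hN (c := b ^ 2) (t := N * t) (by positivity) (by positivity) g hbd
  calc _ ≤ (𝔼 J, if (𝔼 J', g J') + N * t < g J then (1 : ℝ) else 0) := by
        refine Finset.expect_le_expect fun J _ => ?_
        by_cases h : ∀ i, N * σ - 4 * b * Q - N * t ≤ ∑ k, f i (J k) ^ 2
        · rw [if_pos h]; split_ifs <;> norm_num
        · rw [if_neg h, if_pos]
          push Not at h
          obtain ⟨i, hi⟩ := h
          have := le_ciSup (hbg J) i
          rw [hg] at hmean ⊢
          simp only at hmean ⊢
          linarith
    _ ≤ _ := hmc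
    _ = _ := by
        congr 1; field_simp

end FiniteProbability

/-! ### Matrix norms, duality and compatibility constants -/

section Deterministic

/-- On a finite-dimensional space every linear functional is bounded relative to any norm. -/
theorem Seminorm.exists_abs_le_mul {V : Type*} [AddCommGroup V] [Module ℝ V]
    [FiniteDimensional ℝ V] (p : Seminorm ℝ V) (hp : ∀ x, p x = 0 → x = 0) (f : V →ₗ[ℝ] ℝ) :
    ∃ C, 0 ≤ C ∧ ∀ x, |f x| ≤ C * p x := by
  let _ : NormedAddCommGroup V := AddGroupNorm.toNormedAddCommGroup
    { p.toAddGroupSeminorm with eq_zero_of_map_eq_zero' := hp }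
  let _ : NormedSpace ℝ V := { norm_smul_le := fun a b => (map_smul_eq_mul p a b).le }
  exact ⟨‖LinearMap.toContinuousLinearMap f‖, norm_nonneg _, fun x =>
    (LinearMap.toContinuousLinearMap f).le_opNorm x⟩

variable {m n : ℕ}

theorem matInner_add_left (A B C : Matrix (Fin m) (Fin n) ℝ) :
    matInner (A + B) C = matInner A C + matInner B C := by
  simp [matInner, add_mul, Finset.sum_add_distrib]

theorem matInner_smul_left (r : ℝ) (A C : Matrix (Fin m) (Fin n) ℝ) :
    matInner (r • A) C = r * matInner A C := by
  simp [matInner, Finset.mul_sum, mul_assoc]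

theorem matInner_comm (A B : Matrix (Fin m) (Fin n) ℝ) : matInner A B = matInner B A := by
  simp [matInner, mul_comm]

theorem matInner_self (A : Matrix (Fin m) (Fin n) ℝ) : matInner A A = frobNorm A ^ 2 := by
  rw [frobNorm, Real.sq_sqrt (by positivity)]
  simp [matInner, sq]

theorem frobNorm_nonneg (A : Matrix (Fin m) (Fin n) ℝ) : 0 ≤ frobNorm A := Real.sqrt_nonneg _

theorem frobNorm_eq_zero {A : Matrix (Fin m) (Fin n) ℝ} : frobNorm A = 0 ↔ A = 0 := by
  constructor
  · intro h
    rw [frobNorm, Real.sqrt_eq_zero (by positivity)] at h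
    ext i j
    have h1 := (Finset.sum_eq_zero_iff_of_nonneg fun i _ => by positivity).mp h i (Finset.mem_univ _)
    have h2 := (Finset.sum_eq_zero_iff_of_nonneg fun j _ => by positivity).mp h1 j
      (Finset.mem_univ _)
    simpa using h2
  · rintro rfl; simp [frobNorm]

theorem frobNorm_pos {A : Matrix (Fin m) (Fin n) ℝ} (hA : A ≠ 0) : 0 < frobNorm A :=
  (frobNorm_nonneg A).lt_of_ne fun h => hA (frobNorm_eq_zero.mp h.symm)

theorem frobNorm_smul (r : ℝ) (A : Matrix (Fin m) (Fin n) ℝ) :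
    frobNorm (r • A) = |r| * frobNorm A := by
  rw [frobNorm, frobNorm, ← Real.sqrt_sq_eq_abs, ← Real.sqrt_mul (sq_nonneg r)]
  simp [Finset.mul_sum, mul_pow]

theorem abs_apply_le_frobNorm (A : Matrix (Fin m) (Fin n) ℝ) (i : Fin m) (j : Fin n) :
    |A i j| ≤ frobNorm A := by
  refine Real.abs_le_sqrt ?_
  calc A i j ^ 2 ≤ ∑ j, A i j ^ 2 :=
        Finset.single_le_sum (f := fun j => A i j ^ 2) (fun _ _ => sq_nonneg _) (Finset.mem_univ j)
    _ ≤ _ := Finset.single_le_sum (f := fun i => ∑ j, A i j ^ 2)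
        (fun _ _ => by positivity) (Finset.mem_univ i)

theorem abs_apply_le_maxNorm (A : Matrix (Fin m) (Fin n) ℝ) (p : Fin m × Fin n) :
    |A p.1 p.2| ≤ maxNorm A :=
  le_ciSup (f := fun p : Fin m × Fin n => |A p.1 p.2|) (Set.finite_range _).bddAbove p

variable {R : Seminorm ℝ (Matrix (Fin m) (Fin n) ℝ)}

/-- Finite dimension makes the set in `dualNorm` bounded, so its `sSup` is a true supremum and not
the default 0; the rest is scaling `A` to the unit ball. -/
theorem matInner_le_mul_dualNorm (hR : IsMatrixNorm R) (A Y : Matrix (Fin m) (Fin n) ℝ) :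
    matInner A Y ≤ R A * dualNorm R Y := by
  obtain ⟨C, hC, hCle⟩ := R.exists_abs_le_mul hR
    { toFun := fun A => matInner A Y
      map_add' := fun A B => matInner_add_left A B Y
      map_smul' := fun r A => matInner_smul_left r A Y }
  simp only [LinearMap.coe_mk, AddHom.coe_mk] at hCle
  have hbdd : BddAbove {r : ℝ | ∃ A, R A ≤ 1 ∧ r = matInner A Y} := by
    refine ⟨C, ?_⟩
    rintro _ ⟨A, hA, rfl⟩
    exact (le_abs_self _).trans ((hCle A).trans (mul_le_of_le_one_right hC hA))
  rcases (apply_nonneg R A).eq_or_lt with h | h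
  · rw [hR A h.symm]; simp [matInner]
  · have h1 : matInner ((R A)⁻¹ • A) Y ≤ dualNorm R Y :=
      le_csSup hbdd ⟨_, by
        rw [map_smul_eq_mul, norm_inv, Real.norm_eq_abs, abs_of_pos h, inv_mul_cancel₀ h.ne'], rfl⟩
    rw [matInner_smul_left, inv_mul_le_iff₀ h] at h1
    exact h1

theorem dualNorm_nonneg (hR : IsMatrixNorm R) (Y : Matrix (Fin m) (Fin n) ℝ) :
    0 ≤ dualNorm R Y := by
  by_contra! h
  have h1 := matInner_le_mul_dualNorm hR Y Y
  rw [matInner_self] at h1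
  have h2 : R Y * dualNorm R Y ≤ 0 := mul_nonpos_of_nonneg_of_nonpos (apply_nonneg R Y) h.le
  have h3 : frobNorm Y = 0 := by nlinarith [sq_nonneg (frobNorm Y)]
  have hY := frobNorm_eq_zero.mp h3
  subst hY
  have : (0 : ℝ) ≤ dualNorm R (0 : Matrix (Fin m) (Fin n) ℝ) := by
    refine Real.sSup_nonneg ?_
    rintro _ ⟨A, _, rfl⟩
    simp [matInner]
  linarith

/-- Guarantees that the supremum in `psiMax` is over a bounded set. -/
theorem exists_le_mul_frobNorm (R : Seminorm ℝ (Matrix (Fin m) (Fin n) ℝ)) :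
    ∃ C, ∀ A, R A ≤ C * frobNorm A := by
  refine ⟨∑ i, ∑ j, R (Matrix.single i j 1), fun A => ?_⟩
  have hsub : ∀ (ι : Type) (s : Finset ι) (g : ι → Matrix (Fin m) (Fin n) ℝ),
      R (∑ i ∈ s, g i) ≤ ∑ i ∈ s, R (g i) := fun _ s g =>
    Finset.le_sum_of_subadditive R (map_zero R).le (map_add_le_add R) s g
  calc R A = R (∑ i, ∑ j, Matrix.single i j (A i j)) := by
        rw [← Matrix.matrix_eq_sum_single A]
    _ ≤ ∑ i, ∑ j, R (Matrix.single i j (A i j)) :=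
        (hsub _ _ _).trans (Finset.sum_le_sum fun i _ => hsub _ _ _)
    _ ≤ ∑ i, ∑ j, R (Matrix.single i j 1) * frobNorm A := by
        refine Finset.sum_le_sum fun i _ => Finset.sum_le_sum fun j _ => ?_
        have : Matrix.single i j (A i j) = A i j • Matrix.single i j (1 : ℝ) := by simp
        rw [this, map_smul_eq_mul, mul_comm, Real.norm_eq_abs]
        exact mul_le_mul_of_nonneg_left (abs_apply_le_frobNorm A i j) (apply_nonneg R _)
    _ = _ := by simp only [Finset.sum_mul]

theorem bddAbove_ratio (V : Submodule ℝ (Matrix (Fin m) (Fin n) ℝ)) :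
    BddAbove {r : ℝ | ∃ A ∈ V, A ≠ 0 ∧ r = R A / frobNorm A} := by
  obtain ⟨C, hC⟩ := exists_le_mul_frobNorm R
  refine ⟨C, ?_⟩
  rintro _ ⟨A, _, hA, rfl⟩
  exact (div_le_iff₀ (frobNorm_pos hA)).mpr (hC A)

theorem le_psiMax_mul_frobNorm {V : Submodule ℝ (Matrix (Fin m) (Fin n) ℝ)}
    {A : Matrix (Fin m) (Fin n) ℝ} (hA : A ∈ V) : R A ≤ psiMax R V * frobNorm A := by
  rcases eq_or_ne A 0 with rfl | h
  · simp [frobNorm_eq_zero.mpr rfl]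
  · exact (div_le_iff₀ (frobNorm_pos h)).mp (le_csSup (bddAbove_ratio V) ⟨A, hA, h, rfl⟩)

theorem psiMax_nonneg (V : Submodule ℝ (Matrix (Fin m) (Fin n) ℝ)) : 0 ≤ psiMax R V := by
  refine Real.sSup_nonneg ?_
  rintro _ ⟨A, _, _, rfl⟩
  exact div_nonneg (apply_nonneg R A) (frobNorm_nonneg A)

theorem psiMin_nonneg (R : Seminorm ℝ (Matrix (Fin m) (Fin n) ℝ)) : 0 ≤ psiMin R := by
  refine Real.sInf_nonneg ?_
  rintro _ ⟨A, _, rfl⟩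
  exact div_nonneg (apply_nonneg R A) (frobNorm_nonneg A)

theorem psiMin_le_psiMax {V : Submodule ℝ (Matrix (Fin m) (Fin n) ℝ)} (hV : V ≠ ⊥) :
    psiMin R ≤ psiMax R V := by
  obtain ⟨A, hA, h⟩ := V.exists_mem_ne_zero_of_ne_bot hV
  have hbdd : BddBelow {r : ℝ | ∃ A : Matrix (Fin m) (Fin n) ℝ, A ≠ 0 ∧ r = R A / frobNorm A} := by
    refine ⟨0, ?_⟩
    rintro _ ⟨A, _, rfl⟩
    exact div_nonneg (apply_nonneg R A) (frobNorm_nonneg A)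
  exact (csInf_le hbdd ⟨A, h, rfl⟩).trans (le_csSup (bddAbove_ratio V) ⟨A, hA, h, rfl⟩)

theorem psiMax_pos (hR : IsMatrixNorm R) {V : Submodule ℝ (Matrix (Fin m) (Fin n) ℝ)}
    (hV : V ≠ ⊥) : 0 < psiMax R V := by
  obtain ⟨A, hA, h⟩ := V.exists_mem_ne_zero_of_ne_bot hV
  have h1 : 0 < R A := (apply_nonneg R A).lt_of_ne fun h' => h (hR A h'.symm)
  exact (div_pos h1 (frobNorm_pos h)).trans_le (le_csSup (bddAbove_ratio V) ⟨A, hA, h, rfl⟩)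

/-- Orthogonal decomposition along a subspace for the trace inner product. -/
theorem exists_orthogonal_decomposition (V : Submodule ℝ (Matrix (Fin m) (Fin n) ℝ))
    (A : Matrix (Fin m) (Fin n) ℝ) :
    ∃ U ∈ V, ∃ Y, IsOrthTo V Y ∧ A = U + Y ∧ frobNorm U ≤ frobNorm A := by
  let b : LinearMap.BilinForm ℝ (Matrix (Fin m) (Fin n) ℝ) :=
    LinearMap.mk₂ ℝ matInner matInner_add_left (fun r A B => matInner_smul_left r A B)
      (fun A B C => by rw [matInner_comm, matInner_add_left, matInner_comm B, matInner_comm C])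
      (fun r A B => by rw [matInner_comm, matInner_smul_left, matInner_comm B]; rfl)
  have hb : ∀ A B, b A B = matInner A B := fun _ _ => rfl
  have hrefl : b.IsRefl := fun A B h => by rw [hb] at h ⊢; rw [matInner_comm, h]
  -- Positive definiteness gives disjointness, which in finite dimension already gives a complement.
  have hdis : Disjoint V (b.orthogonal V) := by
    rw [Submodule.disjoint_def]
    intro x hx hx'
    have : matInner x x = 0 := hx' x hx
    rw [matInner_self] at this
    exact frobNorm_eq_zero.mp (pow_eq_zero_iff two_ne_zero |>.mp this)
  have hcompl := (LinearMap.BilinForm.isCompl_orthogonal_iff_disjoint hrefl).mpr hdis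
  obtain ⟨U, hU, Y, hY, hUY⟩ := Submodule.mem_sup.mp
    (hcompl.sup_eq_top ▸ Submodule.mem_top : A ∈ V ⊔ b.orthogonal V)
  have hY' : IsOrthTo V Y := fun Z hZ => hY Z hZ
  refine ⟨U, hU, Y, hY', hUY.symm, ?_⟩
  refine le_of_sq_le_sq ?_ (frobNorm_nonneg A)
  rw [← matInner_self, ← matInner_self, ← hUY, matInner_add_left, matInner_comm U (U + Y),
    matInner_comm Y (U + Y), matInner_add_left, matInner_add_left, matInner_comm Y U, hY' U hU,
    matInner_self Y]
  nlinarith [sq_nonneg (frobNorm Y)]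

theorem matInner_single (A : Matrix (Fin m) (Fin n) ℝ) (i : Fin m) (j : Fin n) (c : ℝ) :
    matInner A (Matrix.single i j c) = A i j * c := by
  rw [matInner, Finset.sum_eq_single i, Finset.sum_eq_single j]
  · simp
  · intro b _ hb; simp [hb.symm]
  · simp
  · intro b _ hb; simp [hb.symm]
  · simp

theorem matInner_sum_single {N : ℕ} (A : Matrix (Fin m) (Fin n) ℝ) (I : Fin N → Fin m × Fin n)
    (c : Fin N → ℝ) :
    matInner A (∑ k, Matrix.single (I k).1 (I k).2 (c k)) = ∑ k, A (I k).1 (I k).2 * c k := by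
  have h : ∀ s : Finset (Fin N), matInner A (∑ k ∈ s, Matrix.single (I k).1 (I k).2 (c k))
      = ∑ k ∈ s, matInner A (Matrix.single (I k).1 (I k).2 (c k)) := by
    intro s
    induction s using Finset.induction_on with
    | empty => simp [matInner]
    | insert a s ha ih =>
      rw [Finset.sum_insert ha, Finset.sum_insert ha, matInner_comm, matInner_add_left,
        matInner_comm _ A, matInner_comm _ A, ih]
  rw [h]
  exact Finset.sum_congr rfl fun k _ => matInner_single _ _ _ _

/-! ### Curvature and the basic inequality -/

/-- Quadratic lower bound for the Bregman divergence of a function with curvature at least `τ`. -/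
theorem bregman_lower_bound {G : ℝ → ℝ} (hG : ∀ θ, AnalyticAt ℝ G θ) {τ r x y : ℝ}
    (hτ : ∀ u, |u| ≤ r → τ ≤ iteratedDeriv 2 G u) (hx : |x| ≤ r) (hy : |y| ≤ r) :
    τ / 2 * (y - x) ^ 2 ≤ G y - G x - deriv G x * (y - x) := by
  -- Removing the quadratic of curvature `τ` leaves a function convex on `[-r, r]`; its tangent-line
  -- inequality at `x` is the claim.
  set F : ℝ → ℝ := fun u => G u - τ / 2 * u ^ 2 with hF
  have hd : ∀ u, HasDerivAt F (deriv G u - τ * u) u := by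
    intro u
    have := (hG u).differentiableAt.hasDerivAt.sub
      (((hasDerivAt_id u).pow 2).const_mul (τ / 2))
    refine this.congr_deriv ?_
    simp only [id, Nat.cast_ofNat]; ring
  have hdF : deriv F = fun u => deriv G u - τ * u := funext fun u => (hd u).deriv
  have hd2 : ∀ u, HasDerivAt (deriv F) (iteratedDeriv 2 G u - τ) u := by
    intro u
    rw [hdF, iteratedDeriv_succ, iteratedDeriv_one]
    refine ((hG u).deriv.differentiableAt.hasDerivAt.sub
      ((hasDerivAt_id u).const_mul τ)).congr_deriv ?_
    rw [mul_one]
  have hconv : ConvexOn ℝ (Set.Icc (-r) r) F := by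
    refine convexOn_of_deriv2_nonneg' (convex_Icc _ _)
      (fun u _ => (hd u).differentiableAt.differentiableWithinAt)
      (fun u _ => (hd2 u).differentiableAt.differentiableWithinAt) fun u hu => ?_
    rw [Function.iterate_succ_apply, Function.iterate_one, (hd2 u).deriv]
    exact sub_nonneg.mpr (hτ u (abs_le.mpr hu))
  have hxm : x ∈ Set.Icc (-r) r := abs_le.mp hx
  have hym : y ∈ Set.Icc (-r) r := abs_le.mp hy
  have key : (deriv G x - τ * x) * (y - x) ≤ F y - F x := by
    rcases lt_trichotomy x y with h | rfl | h
    · have := hconv.le_slope_of_hasDerivAt hxm hym h (hd x)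
      rwa [slope_def_field, le_div_iff₀ (sub_pos.mpr h)] at this
    · simp
    · have := hconv.slope_le_of_hasDerivAt hym hxm h (hd x)
      rw [slope_def_field, div_le_iff₀ (sub_pos.mpr h)] at this
      linarith
  rw [hF] at key
  simp only at key
  nlinarith [key]

variable {N : ℕ} {M Mbar : Submodule ℝ (Matrix (Fin m) (Fin n) ℝ)} {G : ℝ → ℝ} {lam α η : ℝ}
  {I : Fin N → Fin m × Fin n} {X Θstar Θhat : Matrix (Fin m) (Fin n) ℝ}

/-- The basic inequality for the estimator, with the cone condition it implies. -/
theorem estimator_basic_inequality (hR : IsMatrixNorm R)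
    (hdec : IsDecomposable R M Mbar) (hG : ∀ θ, AnalyticAt ℝ G θ) (hη : 0 < η) (hα : 0 < α)
    (hcurv : ∀ u : ℝ, Real.exp (-(η * |u|)) ≤ iteratedDeriv 2 G u) (hΘ : Θstar ∈ M)
    (hmax : maxNorm Θstar ≤ α / Real.sqrt ((m : ℝ) * n)) (hlam : 0 < lam)
    (hnoise : (m : ℝ) * n / N * dualNorm R (sampleOp I (X - gradMap G Θstar)) ≤ lam / 2)
    (hest : IsEstimator G R lam α I X Θhat) :
    R (Θhat - Θstar) ≤ 4 * (psiMax R Mbar * frobNorm (Θhat - Θstar)) ∧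
    Real.exp (-(2 * η * α / Real.sqrt ((m : ℝ) * n))) *
      ((m : ℝ) * n / N * ∑ k, (Θhat - Θstar) (I k).1 (I k).2 ^ 2) ≤
        3 * lam * (psiMax R Mbar * frobNorm (Θhat - Θstar)) := by
  set Δ := Θhat - Θstar with hΔ
  set a : ℝ := (m : ℝ) * n / N with ha
  set r : ℝ := α / Real.sqrt ((m : ℝ) * n) with hr
  set τ : ℝ := Real.exp (-(2 * η * α / Real.sqrt ((m : ℝ) * n))) with hτ
  have ha0 : 0 ≤ a := by positivity
  have hr0 : 0 ≤ r := by positivity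
  have hτ0 : 0 < τ := Real.exp_pos _
  have hτG : ∀ u, |u| ≤ r → τ ≤ iteratedDeriv 2 G u := by
    intro u hu
    refine le_trans (Real.exp_le_exp.mpr (neg_le_neg ?_)) (hcurv u)
    have : 2 * η * α / Real.sqrt ((m : ℝ) * n) = 2 * (η * r) := by rw [hr]; ring
    rw [this]
    nlinarith [mul_le_mul_of_nonneg_left hu hη.le, mul_nonneg hη.le hr0]
  have hbreg : τ / 2 * ∑ k, Δ (I k).1 (I k).2 ^ 2 ≤
      ∑ k, (G (Θhat (I k).1 (I k).2) - G (Θstar (I k).1 (I k).2)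
        - deriv G (Θstar (I k).1 (I k).2) * Δ (I k).1 (I k).2) := by
    rw [Finset.mul_sum]
    refine Finset.sum_le_sum fun k _ => ?_
    have := bregman_lower_bound hG hτG ((abs_apply_le_maxNorm Θstar (I k)).trans hmax)
      ((abs_apply_le_maxNorm Θhat (I k)).trans hest.1)
    simpa [hΔ] using this
  have hdual : a * ∑ k, Δ (I k).1 (I k).2 * (X - gradMap G Θstar) (I k).1 (I k).2
      ≤ lam / 2 * R Δ := by
    rw [← matInner_sum_single Δ I fun k => (X - gradMap G Θstar) (I k).1 (I k).2]
    calc _ ≤ a * (R Δ * dualNorm R (sampleOp I (X - gradMap G Θstar))) :=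
          mul_le_mul_of_nonneg_left (matInner_le_mul_dualNorm hR _ _) ha0
      _ = a * dualNorm R (sampleOp I (X - gradMap G Θstar)) * R Δ := by ring
      _ ≤ _ := mul_le_mul_of_nonneg_right hnoise (apply_nonneg R Δ)
  have hopt := hest.2 Θstar hmax
  rw [objective, objective] at hopt
  -- The Bregman divergence is the loss difference plus the noise paired with `Δ`; optimality bounds
  -- the former, duality the latter.
  have hsum : ∑ k, (G (Θhat (I k).1 (I k).2) - G (Θstar (I k).1 (I k).2)
        - deriv G (Θstar (I k).1 (I k).2) * Δ (I k).1 (I k).2)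
      = ∑ k, (G (Θhat (I k).1 (I k).2) - X (I k).1 (I k).2 * Θhat (I k).1 (I k).2)
        - ∑ k, (G (Θstar (I k).1 (I k).2) - X (I k).1 (I k).2 * Θstar (I k).1 (I k).2)
        + ∑ k, Δ (I k).1 (I k).2 * (X - gradMap G Θstar) (I k).1 (I k).2 := by
    rw [← Finset.sum_sub_distrib, ← Finset.sum_add_distrib]
    refine Finset.sum_congr rfl fun k _ => ?_
    simp only [hΔ, gradMap, Matrix.sub_apply, Matrix.of_apply]
    ring
  have hmain : τ / 2 * (a * ∑ k, Δ (I k).1 (I k).2 ^ 2) ≤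
      lam / 2 * R Δ + lam * (R Θstar - R Θhat) := by
    have := mul_le_mul_of_nonneg_left hbreg ha0
    rw [hsum] at this
    linarith
  obtain ⟨U, hU, Y, hY, hUY, hUle⟩ := exists_orthogonal_decomposition Mbar Δ
  have hRU : R U ≤ psiMax R Mbar * frobNorm Δ :=
    (le_psiMax_mul_frobNorm hU).trans (mul_le_mul_of_nonneg_left hUle (psiMax_nonneg _))
  have hRΔ : R Δ ≤ R U + R Y := hUY ▸ map_add_le_add R U Y
  -- Decomposability at `Θstar + Y = Θhat - U`: the component of the error outside `Mbar` is paid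
  -- for in full by the penalty.
  have hRhat : R Θstar + R Y - R U ≤ R Θhat := by
    rw [← hdec Θstar hΘ Y hY]
    have : Θstar + Y = Θhat - U := by
      rw [eq_sub_iff_add_eq, add_assoc, add_comm Y U, ← hUY, hΔ]; abel
    rw [this]
    linarith [map_sub_le_add R Θhat U]
  have hq : 0 ≤ τ / 2 * (a * ∑ k, Δ (I k).1 (I k).2 ^ 2) := by positivity
  have hup : τ / 2 * (a * ∑ k, Δ (I k).1 (I k).2 ^ 2) ≤ 3 * lam / 2 * R U - lam / 2 * R Y := by
    nlinarith [mul_le_mul_of_nonneg_left hRΔ (half_pos hlam).le,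
      mul_le_mul_of_nonneg_left hRhat hlam.le]
  have hRY := apply_nonneg R Y
  -- Nonnegativity of the left side of `hup` gives `R Y ≤ 3 * R U`, hence the cone; dropping `R Y`
  -- gives the quadratic bound.
  constructor
  · have : R Y ≤ 3 * R U := by nlinarith
    linarith
  · nlinarith [mul_le_mul_of_nonneg_left hRU hlam.le, mul_nonneg hlam.le hRY]

end Deterministic

/-! ### Restricted strong convexity under uniform sampling -/

section Main

open Finset

open Classical in
/-- Probabilities of events determined by independent uniform samples are uniform averages. -/
theorem real_setOf_uniform_sample {S T : Type*} [MeasurableSpace S] [Fintype T]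
    [MeasurableSpace T] [MeasurableSingletonClass T] {P : Measure S} [IsProbabilityMeasure P]
    {N : ℕ} {I : Fin N → S → T} (hI : ∀ k, Measurable (I k)) (hindep : iIndepFun I P)
    (hunif : ∀ k x, P.real {ω | I k ω = x} = 1 / (Fintype.card T : ℝ))
    (p : (Fin N → T) → Prop) :
    P.real {ω | p fun k => I k ω} = 𝔼 J : Fin N → T, if p J then (1 : ℝ) else 0 := by
  have hset : ∀ J : Fin N → T, {ω | (fun k => I k ω) = J} = ⋂ k, I k ⁻¹' {J k} := by
    intro J; ext ω; simp [funext_iff]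
  have hmeas : ∀ J : Fin N → T, MeasurableSet {ω | (fun k => I k ω) = J} := by
    intro J
    rw [hset]
    exact MeasurableSet.iInter fun k => hI k (measurableSet_singleton _)
  have hJ : ∀ J : Fin N → T, P.real {ω | (fun k => I k ω) = J} =
      1 / (Fintype.card (Fin N → T) : ℝ) := by
    intro J
    have h := hindep.measure_inter_preimage_eq_mul Finset.univ (sets := fun k => {J k})
      (fun k _ => measurableSet_singleton _)
    simp only [Finset.mem_univ, Set.iInter_true] at h
    rw [hset, Measure.real, h, ENNReal.toReal_prod]
    calc _ = ∏ k : Fin N, 1 / (Fintype.card T : ℝ) :=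
          Finset.prod_congr rfl fun k _ => hunif k (J k)
      _ = _ := by simp
  have hunion : {ω | p fun k => I k ω} =
      ⋃ J ∈ Finset.univ.filter p, {ω | (fun k => I k ω) = J} := by
    ext ω; simp
  rw [hunion, measureReal_biUnion_finset _ fun J _ => hmeas J]
  · rw [Finset.sum_congr rfl fun J _ => hJ J, Fintype.expect_eq_sum_div_card]
    simp [div_eq_mul_inv]
  · intro J _ J' _ hne
    refine Set.disjoint_left.mpr fun ω h h' => hne ?_
    exact (show (fun k => I k ω) = J from h).symm.trans h'

variable {m n N : ℕ}

theorem kappa_nonneg {R : Seminorm ℝ (Matrix (Fin m) (Fin n) ℝ)} (hR : IsMatrixNorm R) :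
    0 ≤ kappa R N :=
  Finset.expect_nonneg fun _ _ => Finset.expect_nonneg fun _ _ =>
    mul_nonneg (by positivity) (dualNorm_nonneg hR _)

/-- Restricted strong convexity holds for the sampled positions `J`, at the unit matrices of
spikiness at most `b` and regularizer at most `4 Ψ`. -/
def RestrictedlyConvex (R : Seminorm ℝ (Matrix (Fin m) (Fin n) ℝ)) (Ψ b : ℝ)
    (J : Fin N → Fin m × Fin n) : Prop :=
  ∀ Δ : Matrix (Fin m) (Fin n) ℝ, frobNorm Δ = 1 →
    (∀ p : Fin m × Fin n, Real.sqrt ((m : ℝ) * n) * |Δ p.1 p.2| ≤ b) → R Δ ≤ 4 * Ψ →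
      1 / 2 - 16 * b * Ψ * kappa R N ≤ (m : ℝ) * n / N * ∑ k, Δ (J k).1 (J k).2 ^ 2

-- The functions `√(mn) Δ` have second moment 1 and sup norm at most `b`, and duality with `R Δ ≤
-- 4Ψ` bounds their mean Rademacher sum by `4ΨNκ`. Taking `t = 1/2` in
-- `uniform_empirical_second_moment` gives all the constants.
open Classical in
theorem expect_not_restrictedlyConvex_le {R : Seminorm ℝ (Matrix (Fin m) (Fin n) ℝ)}
    (hR : IsMatrixNorm R) (hm : 0 < m) (hn : 0 < n) (hN : 0 < N) {Ψ b : ℝ} (hb : 0 < b) :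
    (𝔼 J : Fin N → Fin m × Fin n, if ¬ RestrictedlyConvex R Ψ b J then (1 : ℝ) else 0)
      ≤ Real.exp (-(N / (8 * b ^ 4))) := by
  have : Nonempty (Fin m × Fin n) := ⟨⟨0, hm⟩, ⟨0, hn⟩⟩
  have hm' : (0 : ℝ) < m := by exact_mod_cast hm
  have hn' : (0 : ℝ) < n := by exact_mod_cast hn
  have hN' : (0 : ℝ) < N := by exact_mod_cast hN
  set s : ℝ := Real.sqrt ((m : ℝ) * n) with hs
  have hs0 : 0 < s := Real.sqrt_pos.mpr (by positivity)
  have hs2 : s ^ 2 = (m : ℝ) * n := Real.sq_sqrt (by positivity)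
  let ι := {Δ : Matrix (Fin m) (Fin n) ℝ // frobNorm Δ = 1 ∧
    (∀ p : Fin m × Fin n, s * |Δ p.1 p.2| ≤ b) ∧ R Δ ≤ 4 * Ψ}
  have h := uniform_empirical_second_moment (T := Fin m × Fin n) (ι := ι) hN hb (σ := 1)
    (t := 1 / 2) (Q := 4 * Ψ * N * kappa R N) (by norm_num) (fun Δ p => s * Δ.1 p.1 p.2)
    (fun Δ p => by rw [abs_mul, abs_of_pos hs0]; exact Δ.2.2.1 p)
    (fun Δ => by
      have h1 := Δ.2.1
      rw [frobNorm, Real.sqrt_eq_one] at h1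
      rw [Fintype.expect_eq_sum_div_card, Fintype.card_prod, Fintype.card_fin, Fintype.card_fin]
      simp only [mul_pow, ← Finset.mul_sum, hs2, Fintype.sum_prod_type, h1]
      push_cast
      field_simp)
    (fun J ε => 4 * Ψ * (s * dualNorm R (∑ k, Matrix.single (J k).1 (J k).2 ((ε k : ℤ) : ℝ))))
    (fun J ε Δ => by
      have h1 := matInner_le_mul_dualNorm hR Δ.1
        (∑ k, Matrix.single (J k).1 (J k).2 ((ε k : ℤ) : ℝ))
      have h2 := mul_le_mul_of_nonneg_right Δ.2.2.2 (dualNorm_nonneg hR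
        (∑ k, Matrix.single (J k).1 (J k).2 ((ε k : ℤ) : ℝ)))
      have h3 := mul_le_mul_of_nonneg_left (h1.trans h2) hs0.le
      rw [matInner_sum_single, Finset.mul_sum] at h3
      calc _ = ∑ k, s * (Δ.1 (J k).1 (J k).2 * ((ε k : ℤ) : ℝ)) :=
            Finset.sum_congr rfl fun k _ => by ring
        _ ≤ _ := h3
        _ = _ := by ring)
    (by
      rw [kappa, ← hs]
      simp only [← Finset.mul_expect]
      apply le_of_eq
      field_simp)
  calc _ ≤ _ := Finset.expect_le_expect fun J _ => ?_
    _ ≤ _ := h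
    _ = _ := by congr 1; field_simp; norm_num
  by_cases hJ : ∀ Δ : ι, N * 1 - 4 * b * (4 * Ψ * N * kappa R N) - N * (1 / 2) ≤
      ∑ k, (s * Δ.1 (J k).1 (J k).2) ^ 2
  · rw [if_pos hJ, if_neg]
    rw [not_not]
    intro Δ h1 h2 h3
    have h4 := hJ ⟨Δ, h1, h2, h3⟩
    simp only [mul_pow, ← Finset.mul_sum, hs2] at h4
    rw [div_mul_eq_mul_div, le_div_iff₀ hN']
    linarith
  · rw [if_neg hJ]; split_ifs <;> norm_num

end Main

/-! ### From restricted strong convexity to the error bound -/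

section Rate

variable {m n N : ℕ}

/-- On the event of restricted strong convexity the estimator has the stated rate. -/
theorem estimator_rate {R : Seminorm ℝ (Matrix (Fin m) (Fin n) ℝ)} (hR : IsMatrixNorm R)
    {M Mbar : Submodule ℝ (Matrix (Fin m) (Fin n) ℝ)} (hdec : IsDecomposable R M Mbar)
    {G : ℝ → ℝ} (hG : ∀ θ, AnalyticAt ℝ G θ) {η α lam c₀ : ℝ} (hη : 0 < η) (hα : 0 < α)
    (hcurv : ∀ u : ℝ, Real.exp (-(η * |u|)) ≤ iteratedDeriv 2 G u)
    {X Θstar Θhat : Matrix (Fin m) (Fin n) ℝ} {J : Fin N → Fin m × Fin n} (hΘ : Θstar ∈ M)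
    (hmax : maxNorm Θstar ≤ α / Real.sqrt ((m : ℝ) * n)) (hlam : 0 < lam)
    (hnoise : (m : ℝ) * n / N * dualNorm R (sampleOp J (X - gradMap G Θstar)) ≤ lam / 2)
    (hest : IsEstimator G R lam α J X Θhat)
    (hm : 0 < m) (hn : 1 < n) (hN : 0 < N) (hc₀ : 0 < c₀) (hΨ : 0 < psiMax R Mbar)
    (hμ : 0 < muL R N η α (1 / 6) c₀)
    (hJ : RestrictedlyConvex R (psiMax R Mbar)
      (2 / (c₀ * psiMax R Mbar) * Real.sqrt (N / (n * Real.log n))) J) :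
    frobNorm (Θhat - Θstar) ^ 2 ≤ psiMax R Mbar ^ 2 *
      max (3 * lam ^ 2 / (2 * muL R N η α (1 / 6) c₀ ^ 2))
        (c₀ ^ 2 * α ^ 2 * n * Real.log n / N) := by
  have hm' : (0 : ℝ) < m := by exact_mod_cast hm
  have hn' : (0 : ℝ) < n := by exact_mod_cast (zero_lt_one.trans hn)
  have hN' : (0 : ℝ) < N := by exact_mod_cast hN
  have hL : 0 < Real.log n := Real.log_pos (by exact_mod_cast hn)
  obtain ⟨hcone, hquad⟩ :=
    estimator_basic_inequality hR hdec hG hη hα hcurv hΘ hmax hlam hnoise hest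
  set Ψ := psiMax R Mbar with hΨdef
  set μ := muL R N η α (1 / 6) c₀ with hμdef
  set Δ := Θhat - Θstar with hΔ
  set F := frobNorm Δ with hF
  set L := Real.log n with hLdef
  set w := Real.sqrt (N / (n * L)) with hw
  set b := 2 / (c₀ * Ψ) * w with hb
  have hw0 : 0 < w := Real.sqrt_pos.mpr (by positivity)
  have hw2 : w ^ 2 = N / (n * L) := Real.sq_sqrt (by positivity)
  rcases le_or_gt (F ^ 2) (Ψ ^ 2 * (c₀ ^ 2 * α ^ 2 * n * L / N)) with hsmall | hlarge
  · exact hsmall.trans (mul_le_mul_of_nonneg_left (le_max_right _ _) (sq_nonneg Ψ))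
  have hF0 : 0 < F := (frobNorm_nonneg Δ).lt_of_ne fun h0 => by
    rw [hF, ← h0, zero_pow two_ne_zero] at hlarge
    exact absurd hlarge (not_lt.mpr (by positivity))
  have hκ : 0 ≤ kappa R N := kappa_nonneg hR
  -- The entries of `Δ` are at most `2α/√(mn)`, so a large `F` makes `Δ/F` non-spiky; `b` is chosen
  -- so that the threshold is the second term of the maximum.
  have hspiky : 2 * α ≤ b * F := by
    refine le_of_sq_le_sq ?_ (by positivity)
    have : (b * F) ^ 2 = 4 * N / (c₀ ^ 2 * Ψ ^ 2 * n * L) * F ^ 2 := by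
      rw [hb, mul_pow, mul_pow, hw2]; field_simp; norm_num
    rw [this]
    calc (2 * α) ^ 2
        = 4 * N / (c₀ ^ 2 * Ψ ^ 2 * n * L) * (Ψ ^ 2 * (c₀ ^ 2 * α ^ 2 * n * L / N)) := by
          field_simp; norm_num
      _ ≤ _ := mul_le_mul_of_nonneg_left hlarge.le (by positivity)
  have hs0 : 0 < Real.sqrt ((m : ℝ) * n) := Real.sqrt_pos.mpr (by positivity)
  have hconv := hJ (F⁻¹ • Δ)
    (by rw [frobNorm_smul, abs_of_pos (inv_pos.mpr hF0), inv_mul_cancel₀ hF0.ne'])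
    (fun p => by
      have h1 : |Δ p.1 p.2| ≤ 2 * (α / Real.sqrt ((m : ℝ) * n)) := by
        have h2 := (abs_apply_le_maxNorm Θhat p).trans hest.1
        have h3 := (abs_apply_le_maxNorm Θstar p).trans hmax
        have h4 := abs_sub (Θhat p.1 p.2) (Θstar p.1 p.2)
        rw [hΔ, Matrix.sub_apply]
        linarith
      rw [Matrix.smul_apply, smul_eq_mul, abs_mul, abs_of_pos (inv_pos.mpr hF0)]
      calc Real.sqrt ((m : ℝ) * n) * (F⁻¹ * |Δ p.1 p.2|)
          ≤ Real.sqrt ((m : ℝ) * n) * (F⁻¹ * (2 * (α / Real.sqrt ((m : ℝ) * n)))) := by gcongr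
        _ = 2 * α / F := by field_simp
        _ ≤ b := (div_le_iff₀ hF0).mpr hspiky)
    (by
      rw [map_smul_eq_mul, Real.norm_eq_abs, abs_of_pos (inv_pos.mpr hF0),
        inv_mul_le_iff₀ hF0]
      linarith)
  set Z := (m : ℝ) * n / N * ∑ k, Δ (J k).1 (J k).2 ^ 2 with hZ
  have hscale : (m : ℝ) * n / N * ∑ k, (F⁻¹ • Δ) (J k).1 (J k).2 ^ 2 = Z / F ^ 2 := by
    simp only [Matrix.smul_apply, smul_eq_mul, mul_pow, ← Finset.mul_sum]
    rw [hZ]; field_simp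
  rw [hscale, le_div_iff₀ (by positivity)] at hconv
  set τ := Real.exp (-(2 * η * α / Real.sqrt ((m : ℝ) * n))) with hτ
  have hμeq : μ = τ * (1 / 6 - 64 / c₀ * (kappa R N * w)) := by
    rw [hμdef, muL, ← hτ]
    have : (N : ℝ) * kappa R N ^ 2 / (n * Real.log n) = kappa R N ^ 2 * (N / (n * L)) := by ring
    rw [this, Real.sqrt_mul (sq_nonneg _), Real.sqrt_sq hκ]
  have hbκ : 16 * b * Ψ * kappa R N = 32 / c₀ * (kappa R N * w) := by
    rw [hb]; field_simp; ring
  have hlow : 3 * μ * F ^ 2 ≤ 3 * lam * (Ψ * F) := by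
    refine le_trans ?_ hquad
    rw [hμeq]
    -- `3 * (1/6)` matches the constant `1/2`, and `3 * 64` exceeds the needed 32.
    have h1 : 3 * (1 / 6 - 64 / c₀ * (kappa R N * w)) * F ^ 2 ≤ Z := by
      refine le_trans (mul_le_mul_of_nonneg_right ?_ (sq_nonneg F)) hconv
      rw [hbκ]
      have e : 64 / c₀ * (kappa R N * w) = 2 * (32 / c₀ * (kappa R N * w)) := by ring
      have : 0 ≤ 32 / c₀ * (kappa R N * w) := by positivity
      rw [e]; linarith
    have := mul_le_mul_of_nonneg_left h1 (Real.exp_pos (-(2 * η * α / Real.sqrt ((m : ℝ) * n)))).le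
    rw [← hτ] at this
    linarith
  have hlin : μ * F ≤ lam * Ψ := by
    refine le_of_mul_le_mul_right ?_ hF0
    linarith
  have hsq : F ^ 2 ≤ Ψ ^ 2 * (lam ^ 2 / μ ^ 2) := by
    have h1 : F ≤ lam * Ψ / μ := (le_div_iff₀ hμ).mpr (by linarith)
    calc F ^ 2 ≤ (lam * Ψ / μ) ^ 2 := pow_le_pow_left₀ hF0.le h1 2
      _ = _ := by ring
  refine hsq.trans (mul_le_mul_of_nonneg_left (le_trans ?_ (le_max_left _ _)) (sq_nonneg Ψ))
  rw [div_le_div_iff₀ (by positivity) (by positivity)]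
  nlinarith [mul_pos (pow_pos hlam 2) (pow_pos hμ 2)]

end Rate

/-! ### Choice of constants and the good event -/

theorem theorem1 :
    ∀ β : ℝ, 0 < β → ∃ K : ℝ, 0 < K ∧ ∃ C : ℝ, 0 < C ∧ ∀ c₀ : ℝ, C ≤ c₀ →
      ∀ (m n N : ℕ), 0 < m → m ≤ n → 0 < N → N ≤ n ^ 2 →
      -- the regularizer, the model subspaces and decomposability
      ∀ (R : Seminorm ℝ (Matrix (Fin m) (Fin n) ℝ)), IsMatrixNorm R →
      ∀ (M Mbar : Submodule ℝ (Matrix (Fin m) (Fin n) ℝ)), M ≤ Mbar → IsDecomposable R M Mbar →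
      -- the exponential family and the curvature of its log-partition function
      ∀ (ρ : MeasureTheory.Measure ℝ) (h G : ℝ → ℝ), IsNaturalExponentialFamily ρ h G →
      ∀ η : ℝ, 0 < η → (∀ u : ℝ, Real.exp (-(η * |u|)) ≤ iteratedDeriv 2 G u) →
      -- the target matrix is structured and not spiky
      ∀ Θstar ∈ M, ∀ α : ℝ, 0 < α → maxNorm Θstar ≤ α / Real.sqrt ((m : ℝ) * n) →
      -- the observations
      ∀ {S : Type*} [MeasurableSpace S] (P : MeasureTheory.Measure S)
        [MeasureTheory.IsProbabilityMeasure P]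
        (X : S → Matrix (Fin m) (Fin n) ℝ) (I : Fin N → S → Fin m × Fin n),
      IsObservationModel P ρ h G Θstar X I →
      c₀ * psiMax R Mbar ^ 2 * n * Real.log n ≤ N →
      0 < muL R N η α K c₀ →
      ∃ E : Set S, MeasurableSet E ∧
        1 - 4 * Real.exp (-((1 + β) * psiMin R ^ 4 * Real.log n ^ 2)) < P.real E ∧
        ∀ ω ∈ E, ∀ lam : ℝ, 0 < lam →
          (m : ℝ) * n / N * dualNorm R (sampleOp (fun k => I k ω) (X ω - gradMap G Θstar))
            ≤ lam / 2 →
          ∀ Θhat : Matrix (Fin m) (Fin n) ℝ,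
            IsEstimator G R lam α (fun k => I k ω) (X ω) Θhat →
            frobNorm (Θhat - Θstar) ^ 2 ≤
              psiMax R Mbar ^ 2 *
                max (3 * lam ^ 2 / (2 * muL R N η α K c₀ ^ 2))
                  (c₀ ^ 2 * α ^ 2 * n * Real.log n / N) := by
  intro β hβ
  -- `C` ensures `c₀ ≥ 1` and thus `c₀⁴/128 ≥ c₀/128 ≥ 1 + β`.
  refine ⟨1 / 6, by norm_num, 128 * (1 + β), by positivity, ?_⟩
  intro c₀ hc₀ m n N hm hmn hN hNn R hR M Mbar _ hdec ρ h G hfam η hη hcurv Θstar hΘ α hα hmax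
    S _ P _ X I hobs _ hμ
  have hc₀1 : 1 ≤ c₀ := by linarith
  rcases (show n = 1 ∨ 1 < n by omega) with rfl | hn
  · exact ⟨∅, MeasurableSet.empty, by norm_num, by simp⟩
  -- Here `Ψ = 0`, so the cone condition forces `Θhat = Θstar` on every outcome.
  by_cases hbot : Mbar = ⊥
  · refine ⟨Set.univ, MeasurableSet.univ, ?_, fun ω _ lam hlam hnoise Θhat hest => ?_⟩
    · rw [probReal_univ]
      linarith [Real.exp_pos (-((1 + β) * psiMin R ^ 4 * Real.log n ^ 2))]
    · have hΨ : psiMax R Mbar = 0 := by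
        have : {r : ℝ | ∃ A ∈ Mbar, A ≠ 0 ∧ r = R A / frobNorm A} = ∅ := by
          ext r; simp +contextual [hbot]
        rw [psiMax, this, Real.sSup_empty]
      have h1 := (estimator_basic_inequality hR hdec hfam.analytic hη hα hcurv hΘ hmax hlam
        hnoise hest).1
      rw [hΨ, zero_mul, mul_zero] at h1
      rw [hR _ (le_antisymm h1 (apply_nonneg R _)), frobNorm_eq_zero.mpr rfl, hΨ]
      simp
  have hΨ := psiMax_pos hR hbot
  have hm' : (0 : ℝ) < m := by exact_mod_cast hm
  have hn' : (0 : ℝ) < n := by exact_mod_cast (zero_lt_one.trans hn)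
  have hN' : (0 : ℝ) < N := by exact_mod_cast hN
  have hNn' : (N : ℝ) ≤ n ^ 2 := by exact_mod_cast hNn
  have hL : 0 < Real.log n := Real.log_pos (by exact_mod_cast hn)
  have hc₀0 : 0 < c₀ := by linarith
  set b := 2 / (c₀ * psiMax R Mbar) * Real.sqrt (N / (n * Real.log n)) with hb
  have hb0 : 0 < b := by
    have : 0 < Real.sqrt (N / (n * Real.log n)) := Real.sqrt_pos.mpr (by positivity)
    positivity
  -- The event involves only the sampled positions, so it serves all `lam` and all minimizers at
  -- once.
  set E := {ω | RestrictedlyConvex R (psiMax R Mbar) b fun k => I k ω} with hE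
  have hEmeas : MeasurableSet E :=
    (measurable_pi_lambda (fun ω k => I k ω) hobs.measurable_index)
      (Set.toFinite {J | RestrictedlyConvex R (psiMax R Mbar) b J}).measurableSet
  refine ⟨E, hEmeas, ?_, fun ω hω lam hlam hnoise Θhat hest => ?_⟩
  · have hcompl : P.real Eᶜ ≤ Real.exp (-(N / (8 * b ^ 4))) := by
      have h1 := real_setOf_uniform_sample (P := P) hobs.measurable_index hobs.indep_index
        (fun k p => by rw [hobs.uniform_index k p]; simp)
        (fun J => ¬ RestrictedlyConvex R (psiMax R Mbar) b J)
      rw [show Eᶜ = {ω | ¬ RestrictedlyConvex R (psiMax R Mbar) b fun k => I k ω} from rfl, h1]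
      convert expect_not_restrictedlyConvex_le hR hm (zero_lt_one.trans hn) hN hb0
    -- `b⁴` is proportional to `N²`, so the exponent carries the factor `n²/N`, which is at least 1.
    have hrate : (1 + β) * psiMin R ^ 4 * Real.log n ^ 2 ≤ N / (8 * b ^ 4) := by
      have hb4 : b ^ 4 = 16 * N ^ 2 / (c₀ ^ 4 * psiMax R Mbar ^ 4 * n ^ 2 * Real.log n ^ 2) := by
        have : b ^ 4 = (2 / (c₀ * psiMax R Mbar)) ^ 4 *
            (Real.sqrt (N / (n * Real.log n)) ^ 2) ^ 2 := by rw [hb]; ring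
        rw [this, Real.sq_sqrt (by positivity)]
        field_simp; norm_num
      have h1 : N / (8 * b ^ 4) =
          c₀ ^ 4 / 128 * psiMax R Mbar ^ 4 * Real.log n ^ 2 * (n ^ 2 / N) := by
        rw [hb4]; field_simp; norm_num
      have h2 : 1 + β ≤ c₀ ^ 4 / 128 := by
        have : c₀ ≤ c₀ ^ 4 := le_self_pow₀ hc₀1 (by norm_num)
        linarith
      have h3 : psiMin R ^ 4 ≤ psiMax R Mbar ^ 4 :=
        pow_le_pow_left₀ (psiMin_nonneg R) (psiMin_le_psiMax hbot) 4
      have h4 : 1 ≤ (n : ℝ) ^ 2 / N := (one_le_div hN').mpr hNn'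
      rw [h1]
      calc (1 + β) * psiMin R ^ 4 * Real.log n ^ 2
          ≤ c₀ ^ 4 / 128 * psiMax R Mbar ^ 4 * Real.log n ^ 2 := by gcongr
        _ ≤ _ := le_mul_of_one_le_right (by positivity) h4
    have h5 := probReal_compl_eq_one_sub (μ := P) hEmeas
    have h6 := Real.exp_le_exp.mpr (neg_le_neg hrate)
    have h7 := Real.exp_pos (-((1 + β) * psiMin R ^ 4 * Real.log n ^ 2))
    linarith
  · exact estimator_rate hR hdec hfam.analytic hη hα hcurv hΘ hmax hlam hnoise hest hm hn hN
      hc₀0 hΨ hμ hω
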